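/- Consider $m$ jobs on a single machine with preemption, where job $j$ has release time $r_j\ge 0$ and processing time $p_j\ge 0$. In a schedule on a machine of speed $s$, job $j$ is processed at time $t$ at a rate $\rho_j(t)\ge 0$ (a measurable function of $t$) with $\sum_j\rho_j(t)\le s$; its elapsed time is $w_j(t)=\int_0^t\rho_j$. The job is *active* at time $t$ if $r_j\le t$ and $w_j(t)<p_j$, and only active jobs may be processed. Its completion time $C_j$ is the first time $t\ge r_j$ with $w_j(t)\ge p_j$, and the total flow time is $\sum_{j=1}^m (C_j-r_j)$. *SETF* (shortest elapsed time first) splits the full speed of the machine, at every time, equally between the active jobs of minimum elapsed time; *SRPT* (shortest remaining processing time) devotes, at every time at which some job is active, the full speed to one active job of minimum remaining processing time $p_j-w_j(t)$, with arbitrary tie-breaking. **Theorem.** For every input and every $\epsilon>0$, an SETF schedule on a machine of speed $1+\epsilon$ and an SRPT schedule on a unit-speed machine exist, and every two such schedules complete all jobs. If $X_t$ and $X^*_t$ denote the sets of jobs active at time $t$ under SETF with speed $1+\epsilon$ and under SRPT with unit speed, respectively, then $$|X_t|\le\Bigl(1+\frac1\epsilon\Bigr)|X^*_t|\qquad\text{for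 every time } t,$$ and the total flow time of the SETF schedule is at most $1+\frac1\epsilon$ times the total flow time of the SRPT schedule. -/

import Mathlib

namespace FlowScheduling

/-- An input with `m` jobs: job `j` is released at time `release j ≥ 0` and needs `proc j` units of
processing. -/
structure JobInput (m : ℕ) where
  release : Fin m → ℝ
  proc : Fin m → ℝ
  release_nonneg : ∀ j, 0 ≤ release j
  proc_nonneg : ∀ j, 0 ≤ proc j

/-- A feasible preemptive schedule on one machine of the given speed: `rate j t` is the rate at
which job `j` is processed at time `t`. The machine may be shared, the total rate never exceeds the
speed, and a job is processed only while it is released and has received less than its processing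
time. -/
structure Schedule {m : ℕ} (J : JobInput m) (speed : ℝ) where
  rate : Fin m → ℝ → ℝ
  measurable_rate : ∀ j, Measurable (rate j)
  rate_nonneg : ∀ j t, 0 ≤ rate j t
  sum_rate_le : ∀ t, ∑ j, rate j t ≤ speed
  rate_eq_zero : ∀ j t,
    ¬ (J.release j ≤ t ∧ ∫ s in (0 : ℝ)..t, rate j s < J.proc j) → rate j t = 0

namespace Schedule

variable {m : ℕ} {J : JobInput m} {speed : ℝ}

/-- The amount of processing that job `j` has received by time `t`. -/
noncomputable def elapsed (S : Schedule J speed) (j : Fin m) (t : ℝ) : ℝ :=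
  ∫ s in (0 : ℝ)..t, S.rate j s

/-- The amount of processing that job `j` still needs at time `t`. -/
noncomputable def remaining (S : Schedule J speed) (j : Fin m) (t : ℝ) : ℝ :=
  J.proc j - S.elapsed j t

/-- The jobs that are active at time `t`: released but not yet completed. -/
noncomputable def active (S : Schedule J speed) (t : ℝ) : Finset (Fin m) :=
  Finset.univ.filter fun j => J.release j ≤ t ∧ S.elapsed j t < J.proc j

/-- The active jobs that have been processed the least so far. -/
noncomputable def leastElapsed (S : Schedule J speed) (t : ℝ) : Finset (Fin m) :=
  (S.active t).filter fun j => ∀ k ∈ S.active t, S.elapsed j t ≤ S.elapsed k t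

/-- Shortest elapsed time first: at all times the full speed of the machine is split equally
between the active jobs that have been processed the least so far. -/
def IsSETF (S : Schedule J speed) : Prop :=
  ∀ t j, S.rate j t = if j ∈ S.leastElapsed t then speed / ((S.leastElapsed t).card : ℝ) else 0

/-- Shortest remaining processing time: whenever some job is active, the machine devotes its full
speed to one active job that is closest to completion (ties are broken arbitrarily). -/
def IsSRPT (S : Schedule J speed) : Prop :=
  ∀ t, (S.active t).Nonempty →
    ∃ j ∈ S.active t, (∀ k ∈ S.active t, S.remaining j t ≤ S.remaining k t) ∧
      S.rate j t = speed ∧ ∀ k, k ≠ j → S.rate k t = 0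

/-- The times at which job `j` is completed. -/
def completedTimes (S : Schedule J speed) (j : Fin m) : Set ℝ :=
  {t | J.release j ≤ t ∧ J.proc j ≤ S.elapsed j t}

/-- Every job is eventually completed. -/
def CompletesAll (S : Schedule J speed) : Prop :=
  ∀ j, (S.completedTimes j).Nonempty

/-- The completion time of job `j` (meaningful if `j` is eventually completed). -/
noncomputable def completionTime (S : Schedule J speed) (j : Fin m) : ℝ :=
  sInf (S.completedTimes j)

/-- The total flow time `∑ j, (C j - r j)`. -/
noncomputable def totalFlowTime (S : Schedule J speed) : ℝ :=
  ∑ j, (S.completionTime j - J.release j)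

end Schedule

end FlowScheduling

open MeasureTheory Set Filter Topology
open scoped NNReal

namespace FlowScheduling

/-! ### Elapsed times and active sets -/

namespace Schedule

variable {m : ℕ} {J : JobInput m} {speed : ℝ} (S : Schedule J speed)

/-! Fix `t`, let `X` be the active set of the unit-speed schedule and `D` the jobs that only SETF
still has active. It suffices that `ε * |D| ≤ |X|`; integrating the pointwise bound over `t` then
bounds the flow time, which is the integral of the number of active jobs.

Write `w` for SETF-elapsed time at `t` and fix a level `l`. If some job of `D` has `w ≤ l`, go back
to the start `τ` of the period ending at `t` in which a job of elapsed time at most `l` is always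
active (`IsSETF.exists_busy_period`). SETF spends its whole capacity `(1 + ε) * (t - τ)` there on
jobs released in the period. Those outside `X` are finished by the other machine, so their `w` sums
to at most `t - τ`. The others, in `X`, therefore carry at least `ε * (t - τ)`, that is, at least
`ε` times what the jobs of `D` with `w ≤ l` carry (`IsSETF.mul_sum_elapsed_le`). Summation by parts
against `1 / w` turns these inequalities, one for each `l`, into the inequality of cardinalities.

The comparison holds against every unit-speed schedule; the SRPT rule serves only to ensure
completion. Existence of both schedules comes from following a rate rule along straight lines and
continuing past every finite time (`exists_schedule_rate_eq`). -/

theorem rate_le_speed (j : Fin m) (t : ℝ) : S.rate j t ≤ speed :=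
  (Finset.single_le_sum (fun i _ => S.rate_nonneg i t) (Finset.mem_univ j)).trans (S.sum_rate_le t)

theorem intervalIntegrable_rate (j : Fin m) (a b : ℝ) :
    IntervalIntegrable (S.rate j) volume a b := by
  refine (intervalIntegrable_const (c := speed)).mono_fun'
    (S.measurable_rate j).aestronglyMeasurable (ae_of_all _ fun t => ?_)
  exact (Real.norm_of_nonneg (S.rate_nonneg j t)).trans_le (S.rate_le_speed j t)

theorem elapsed_sub (j : Fin m) (a b : ℝ) :
    S.elapsed j b - S.elapsed j a = ∫ s in a..b, S.rate j s :=
  intervalIntegral.integral_interval_sub_left (S.intervalIntegrable_rate j _ _)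
    (S.intervalIntegrable_rate j _ _)

theorem sum_elapsed_sub (A : Finset (Fin m)) (a b : ℝ) :
    ∑ j ∈ A, (S.elapsed j b - S.elapsed j a) = ∫ s in a..b, ∑ j ∈ A, S.rate j s := by
  rw [intervalIntegral.integral_finsetSum fun j _ => S.intervalIntegrable_rate j a b]
  exact Finset.sum_congr rfl fun j _ => S.elapsed_sub j a b

theorem continuous_elapsed (j : Fin m) : Continuous (S.elapsed j) :=
  intervalIntegral.continuous_primitive (fun a b => S.intervalIntegrable_rate j a b) 0

theorem monotone_elapsed (j : Fin m) : Monotone (S.elapsed j) := fun a b hab => by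
  rw [← sub_nonneg, S.elapsed_sub]
  exact intervalIntegral.integral_nonneg hab fun t _ => S.rate_nonneg j t

theorem rate_eq_zero_of_lt_release {j : Fin m} {t : ℝ} (h : t < J.release j) : S.rate j t = 0 :=
  S.rate_eq_zero j t fun h' => h'.1.not_gt h

theorem elapsed_eq_zero {j : Fin m} {t : ℝ} (h : t ≤ J.release j) : S.elapsed j t = 0 := by
  refine intervalIntegral.integral_zero_ae ?_
  -- The rate may be nonzero at the release time itself, a null set. For negative `t` the interval
  -- of integration ends at `0`, which is still no later than the release.
  filter_upwards [compl_mem_ae_iff.2 (measure_singleton (μ := volume) (J.release j))] with x hx hx'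
  refine S.rate_eq_zero_of_lt_release (lt_of_le_of_ne ?_ hx)
  exact hx'.2.trans (max_le (J.release_nonneg j) h)

theorem elapsed_nonneg (j : Fin m) (t : ℝ) : 0 ≤ S.elapsed j t := by
  rcases le_total t (J.release j) with h | h
  · exact (S.elapsed_eq_zero h).ge
  · exact (S.elapsed_eq_zero le_rfl).ge.trans (S.monotone_elapsed j h)

/-- A job that is not processed while its elapsed time exceeds `c` keeps its elapsed time at most
`c`. -/
theorem elapsed_le_of_rate_eq_zero {j : Fin m} {a t c : ℝ} (hat : a ≤ t) (ha : S.elapsed j a ≤ c)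
    (h : ∀ u ∈ Icc a t, c < S.elapsed j u → S.rate j u = 0) : S.elapsed j t ≤ c := by
  have hK : IsCompact (Icc a t ∩ {s | S.elapsed j s ≤ c}) :=
    isCompact_Icc.inter_right (isClosed_le (S.continuous_elapsed j) continuous_const)
  have hmem := hK.sSup_mem ⟨a, ⟨le_rfl, hat⟩, ha⟩
  -- `u` is the last time at which the elapsed time is at most `c`; after it the rate vanishes.
  set u := sSup (Icc a t ∩ {s | S.elapsed j s ≤ c}) with hu
  have hzero : ∫ s in u..t, S.rate j s = 0 := by
    refine intervalIntegral.integral_zero_ae (ae_of_all _ fun s hs => ?_)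
    rw [uIoc_of_le hmem.1.2] at hs
    refine h s ⟨hmem.1.1.trans hs.1.le, hs.2⟩ (lt_of_not_ge fun hc => ?_)
    exact hs.1.not_ge (le_csSup hK.bddAbove ⟨⟨hmem.1.1.trans hs.1.le, hs.2⟩, hc⟩)
  rw [← S.elapsed_sub] at hzero
  rw [sub_eq_zero.1 hzero]
  exact hmem.2

theorem elapsed_le_proc (j : Fin m) (t : ℝ) : S.elapsed j t ≤ J.proc j := by
  rcases le_total t (J.release j) with h | h
  · exact (S.elapsed_eq_zero h).trans_le (J.proc_nonneg j)
  · refine S.elapsed_le_of_rate_eq_zero h ((S.elapsed_eq_zero le_rfl).trans_le (J.proc_nonneg j))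
      fun u _ hu => S.rate_eq_zero j u fun h' => h'.2.not_gt hu

theorem mem_active {j : Fin m} {t : ℝ} :
    j ∈ S.active t ↔ J.release j ≤ t ∧ S.elapsed j t < J.proc j := by
  simp [active]

theorem mem_active_of_le {j : Fin m} {s t : ℝ} (h : j ∈ S.active t) (hs : J.release j ≤ s)
    (hst : s ≤ t) : j ∈ S.active s :=
  S.mem_active.2 ⟨hs, (S.monotone_elapsed j hst).trans_lt (S.mem_active.1 h).2⟩

theorem mem_active_of_rate_ne_zero {j : Fin m} {t : ℝ} (h : S.rate j t ≠ 0) : j ∈ S.active t :=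
  S.mem_active.2 (by_contra fun h' => h (S.rate_eq_zero j t h'))

/-- The machine runs at full speed whenever some job is active. -/
def WorkConserving : Prop :=
  ∀ t, (S.active t).Nonempty → ∑ j, S.rate j t = speed

/-! ### Work conservation, completion and flow time -/

variable {S}

theorem leastElapsed_nonempty {t : ℝ} (h : (S.active t).Nonempty) :
    (S.leastElapsed t).Nonempty := by
  obtain ⟨j, hj, hmin⟩ := (S.active t).exists_min_image (fun j => S.elapsed j t) h
  exact ⟨j, Finset.mem_filter.2 ⟨hj, hmin⟩⟩

theorem IsSETF.workConserving (h : S.IsSETF) : S.WorkConserving := fun t ht => by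
  have hne : ((S.leastElapsed t).card : ℝ) ≠ 0 :=
    Nat.cast_ne_zero.2 (Finset.card_ne_zero.2 (leastElapsed_nonempty ht))
  simp only [h t, Finset.sum_ite_mem, Finset.univ_inter, Finset.sum_const, nsmul_eq_mul]
  field_simp

theorem IsSETF.elapsed_le_of_rate_ne_zero (h : S.IsSETF) {j k : Fin m} {t : ℝ}
    (hj : S.rate j t ≠ 0) (hk : k ∈ S.active t) : S.elapsed j t ≤ S.elapsed k t := by
  have hmem : j ∈ S.leastElapsed t := by
    by_contra hc
    exact hj (by rw [h t j, if_neg hc])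
  exact (Finset.mem_filter.1 hmem).2 k hk

theorem IsSRPT.workConserving (h : S.IsSRPT) : S.WorkConserving := fun t ht => by
  obtain ⟨j, -, -, hj, hk⟩ := h t ht
  rw [Finset.sum_eq_single j (fun k _ hkj => hk k hkj) (by simp), hj]

theorem WorkConserving.sum_elapsed_sub (h : S.WorkConserving) {a b : ℝ} (hab : a ≤ b)
    (hact : ∀ u ∈ Icc a b, (S.active u).Nonempty) :
    ∑ j, (S.elapsed j b - S.elapsed j a) = speed * (b - a) := by
  rw [S.sum_elapsed_sub, intervalIntegral.integral_congr (g := fun _ => speed)]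
  · simp [mul_comm]
  · intro u hu
    rw [uIcc_of_le hab] at hu
    exact h u (hact u hu)

/-- A job that never finished would keep the machine busy forever, and after time `(∑ p + 1) /
speed` more work would have been done than exists. -/
theorem WorkConserving.completesAll (h : S.WorkConserving) (hspeed : 0 < speed) :
    S.CompletesAll := by
  intro j
  by_contra hne
  have hact : ∀ t, J.release j ≤ t → j ∈ S.active t := fun t ht =>
    S.mem_active.2 ⟨ht, lt_of_not_ge fun hp => hne ⟨t, ht, hp⟩⟩
  have hp : 0 ≤ ∑ k, J.proc k := Finset.sum_nonneg fun k _ => J.proc_nonneg k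
  have hd : 0 ≤ (∑ k, J.proc k + 1) / speed := by positivity
  have hsum := h.sum_elapsed_sub (a := J.release j)
    (b := J.release j + (∑ k, J.proc k + 1) / speed) (by linarith) fun u hu => ⟨j, hact u hu.1⟩
  have hle : ∑ k, (S.elapsed k (J.release j + (∑ k, J.proc k + 1) / speed) -
      S.elapsed k (J.release j)) ≤ ∑ k, J.proc k :=
    Finset.sum_le_sum fun k _ => by
      linarith [S.elapsed_le_proc k (J.release j + (∑ k, J.proc k + 1) / speed),
        S.elapsed_nonneg k (J.release j)]
  rw [hsum, add_sub_cancel_left, mul_div_cancel₀ _ hspeed.ne'] at hle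
  linarith

theorem completedTimes_eq_Ici {j : Fin m} (h : (S.completedTimes j).Nonempty) :
    S.completedTimes j = Ici (S.completionTime j) := by
  have hbdd : BddBelow (S.completedTimes j) := ⟨J.release j, fun t ht => ht.1⟩
  have hclosed : IsClosed (S.completedTimes j) :=
    isClosed_Ici.inter (isClosed_le continuous_const (S.continuous_elapsed j))
  have hmem := hclosed.csInf_mem h hbdd
  refine Subset.antisymm (fun t ht => csInf_le hbdd ht) fun t ht => ?_
  exact ⟨hmem.1.trans ht, hmem.2.trans (S.monotone_elapsed j ht)⟩

theorem release_le_completionTime {j : Fin m} (h : (S.completedTimes j).Nonempty) :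
    J.release j ≤ S.completionTime j :=
  le_csInf h fun _ ht => ht.1

theorem mem_active_iff_mem_Ico {j : Fin m} (h : (S.completedTimes j).Nonempty) {t : ℝ} :
    j ∈ S.active t ↔ t ∈ Ico (J.release j) (S.completionTime j) := by
  have := Set.ext_iff.1 (completedTimes_eq_Ici h) t
  simp only [completedTimes, mem_ofPred_eq, mem_Ici] at this
  rw [mem_active, mem_Ico, ← not_le, ← not_le (b := t), ← this]
  tauto

theorem CompletesAll.card_active_eq (h : S.CompletesAll) (t : ℝ) :
    ((S.active t).card : ℝ) =
      ∑ j, (Ico (J.release j) (S.completionTime j)).indicator (fun _ => (1 : ℝ)) t := by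
  rw [Finset.card_eq_sum_ones, Nat.cast_sum, ← Finset.univ_inter (S.active t),
    ← Finset.sum_ite_mem]
  refine Finset.sum_congr rfl fun j _ => ?_
  by_cases hj : j ∈ S.active t
  · simp [hj, indicator_of_mem ((mem_active_iff_mem_Ico (h j)).1 hj)]
  · simp [hj, indicator_of_notMem (fun h' => hj ((mem_active_iff_mem_Ico (h j)).2 h'))]

theorem integrable_indicator_Ico (a b : ℝ) :
    Integrable ((Ico a b).indicator fun _ => (1 : ℝ)) :=
  (integrable_indicator_iff measurableSet_Ico).2 (integrableOn_const (by simp))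

theorem CompletesAll.integrable_card_active (h : S.CompletesAll) :
    Integrable fun t => ((S.active t).card : ℝ) := by
  simp only [h.card_active_eq]
  exact integrable_finsetSum _ fun j _ => integrable_indicator_Ico _ _

/-- The total flow time is the integral of the number of active jobs. -/
theorem CompletesAll.totalFlowTime_eq (h : S.CompletesAll) :
    S.totalFlowTime = ∫ t, ((S.active t).card : ℝ) := by
  simp only [h.card_active_eq]
  rw [integral_finsetSum _ fun j _ => integrable_indicator_Ico _ _]
  refine Finset.sum_congr rfl fun j _ => ?_
  rw [integral_indicator measurableSet_Ico]
  simp [release_le_completionTime (h j)]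

end Schedule

/-! ### Summation by parts -/

/-- The summation by parts behind `sum_nonneg_of_forall_sum_filter_mul_nonneg`. -/
theorem sum_mul_le_mul_sum {ι : Type*} [DecidableEq ι] (a w : ι → ℝ) (s : Finset ι) :
    (∀ k ∈ s, 0 < w k) → ∀ L, (∀ k ∈ s, w k ≤ L) →
      (∀ l < L, 0 ≤ ∑ k ∈ s with w k ≤ l, a k * w k) →
      ∑ k ∈ s, a k * w k ≤ L * ∑ k ∈ s, a k := by
  induction s using Finset.induction_on_max_value w with
  | empty => simp
  | insert x s hx hmax ih =>
    intro hpos L hL hsum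
    have hxpos : 0 < w x := hpos x (Finset.mem_insert_self _ _)
    have hxL : w x ≤ L := hL x (Finset.mem_insert_self _ _)
    -- The new bound is the largest weight `w x`. Segments below it do not contain `x`; this is why
    -- the hypothesis asks for `l < L` strictly, and ties cause no trouble.
    have hs := ih (fun k hk => hpos k (Finset.mem_insert_of_mem hk)) (w x) hmax fun l hl => by
      have := hsum l (hl.trans_le hxL)
      rwa [Finset.filter_insert, if_neg (not_le.2 hl)] at this
    have hall : ∑ k ∈ insert x s, a k * w k ≤ w x * ∑ k ∈ insert x s, a k := by
      rw [Finset.sum_insert hx, Finset.sum_insert hx]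
      linarith
    rcases hxL.eq_or_lt with heq | hlt
    · rwa [← heq]
    -- Raising the factor from `w x` to `L` needs a nonnegative sum of `a`, which follows from the
    -- segment at level `w x`, the whole set.
    · have h0 := hsum (w x) hlt
      rw [Finset.filter_true_of_mem fun k hk => ?_] at h0
      · have hnn : 0 ≤ ∑ k ∈ insert x s, a k := nonneg_of_mul_nonneg_right (h0.trans hall) hxpos
        exact hall.trans (mul_le_mul_of_nonneg_right hxL hnn)
      · rcases Finset.mem_insert.1 hk with rfl | hk
        · exact le_rfl
        · exact hmax k hk

/-- If every initial segment, with respect to the weights `w`, of the sum of `a * w` is nonnegative,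
then so is the sum of `a`: this is summation by parts against the decreasing function `1 / w`. -/
theorem sum_nonneg_of_forall_sum_filter_mul_nonneg {ι : Type*} (a w : ι → ℝ)
    (s : Finset ι) (hpos : ∀ k ∈ s, 0 < w k)
    (hsum : ∀ l, 0 ≤ ∑ k ∈ s with w k ≤ l, a k * w k) : 0 ≤ ∑ k ∈ s, a k := by
  classical
  rcases s.eq_empty_or_nonempty with rfl | hs
  · simp
  obtain ⟨x, hx, hmax⟩ := s.exists_max_image w hs
  have h := sum_mul_le_mul_sum a w s hpos (w x) hmax fun l _ => hsum l
  have h0 := hsum (w x)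
  rw [Finset.filter_true_of_mem hmax] at h0
  exact nonneg_of_mul_nonneg_right (h0.trans h) (hpos x hx)

/-! ### SETF against an arbitrary unit-speed schedule -/

namespace Schedule

variable {m : ℕ} {J : JobInput m} {ε : ℝ} {S : Schedule J (1 + ε)}

/-- For every active job there is a start `τ` of the last period in which jobs of
elapsed time at most `l` are active throughout; SETF spends all of that period on the jobs released
in it, and these include all jobs of elapsed time at most `l` that are still active. -/
theorem IsSETF.exists_busy_period {speed : ℝ} {S : Schedule J speed} (h : S.IsSETF) {t l : ℝ}
    {i : Fin m} (hi : i ∈ S.active t) (hil : S.elapsed i t ≤ l) :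
    ∃ τ ≤ t,
      (∀ k ∈ S.active t, S.elapsed k t ≤ l → τ ≤ J.release k) ∧
      (∀ k, τ ≤ J.release k → J.release k ≤ t → S.elapsed k t ≤ l) ∧
      ∑ k with τ ≤ J.release k ∧ J.release k ≤ t, S.elapsed k t = speed * (t - τ) := by
  classical
  let P : Fin m → Prop := fun j => J.release j ≤ t ∧
    ∀ u ∈ Icc (J.release j) t, ∃ k ∈ S.active u, S.elapsed k u ≤ l
  have hself : ∀ k u, k ∈ S.active u → S.elapsed k u ≤ l →
      ∀ v ∈ Icc (J.release k) u, ∃ k ∈ S.active v, S.elapsed k v ≤ l := fun k u hk hkl v hv =>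
    ⟨k, S.mem_active_of_le hk hv.1 hv.2, (S.monotone_elapsed k hv.2).trans hkl⟩
  have hPi : P i := ⟨(S.mem_active.1 hi).1, hself i t hi hil⟩
  -- The period starts at the earliest release from which a job of elapsed time at most `l` is
  -- active at every moment up to `t`.
  obtain ⟨i₀, hi₀, hmin⟩ := (Finset.univ.filter P).exists_min_image J.release
    ⟨i, Finset.mem_filter.2 ⟨Finset.mem_univ _, hPi⟩⟩
  obtain ⟨hi₀t, hbusy⟩ : P i₀ := (Finset.mem_filter.1 hi₀).2
  -- Such a `k` satisfies `P` itself: it is its own witness up to `u`, and the witnesses of `i₀`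
  -- serve afterwards. Minimality of `i₀` applies.
  have hrel : ∀ u ∈ Icc (J.release i₀) t, ∀ k ∈ S.active u, S.elapsed k u ≤ l →
      J.release i₀ ≤ J.release k := by
    intro u hu k hk hkl
    refine hmin k (Finset.mem_filter.2 ⟨Finset.mem_univ _,
      (S.mem_active.1 hk).1.trans hu.2, fun v hv => ?_⟩)
    rcases le_total v u with hvu | huv
    · exact hself k u hk hkl v ⟨hv.1, hvu⟩
    · exact hbusy v ⟨hu.1.trans huv, hv.2⟩
  have hproc : ∀ u ∈ Icc (J.release i₀) t, ∀ k, S.rate k u ≠ 0 → S.elapsed k u ≤ l := by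
    intro u hu k hk
    obtain ⟨j, hj, hjl⟩ := hbusy u hu
    exact (h.elapsed_le_of_rate_ne_zero hk hj).trans hjl
  refine ⟨J.release i₀, hi₀t, hrel t ⟨hi₀t, le_rfl⟩, fun k hk hkt => ?_, ?_⟩
  · refine S.elapsed_le_of_rate_eq_zero hkt ?_ fun u hu hlt => ?_
    · rw [S.elapsed_eq_zero le_rfl]
      exact (S.elapsed_nonneg i t).trans hil
    · by_contra hne
      exact hlt.not_ge (hproc u ⟨hk.trans hu.1, hu.2⟩ k hne)
  · rw [← h.workConserving.sum_elapsed_sub hi₀t fun u hu => (hbusy u hu).imp fun _ hk => hk.1,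
      Finset.sum_filter]
    refine Finset.sum_congr rfl fun k _ => ?_
    split_ifs with hk
    · rw [S.elapsed_eq_zero hk.1, sub_zero]
    -- A job outside the set gets nothing in the period: if processed at `u`, it would have elapsed
    -- time at most `l` and so be released within the period by `hrel`.
    · rw [S.elapsed_sub]
      refine (intervalIntegral.integral_zero_ae (ae_of_all _ fun u hu => ?_)).symm
      rw [uIoc_of_le hi₀t] at hu
      by_contra hne
      have hu' : u ∈ Icc (J.release i₀) t := ⟨hu.1.le, hu.2⟩
      have hka := S.mem_active_of_rate_ne_zero hne
      exact hk ⟨hrel u hu' k hka (hproc u hu' k hne), (S.mem_active.1 hka).1.trans hu.2⟩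

/-- The jobs released from time `τ` on receive at most `speed * (t - τ)` by time `t`. -/
theorem sum_elapsed_le_of_release {speed : ℝ} (S' : Schedule J speed) {τ t : ℝ} (hτ : τ ≤ t)
    (A : Finset (Fin m)) (hA : ∀ k ∈ A, τ ≤ J.release k) :
    ∑ k ∈ A, S'.elapsed k t ≤ speed * (t - τ) := by
  have h1 : ∑ k ∈ A, S'.elapsed k t = ∑ k ∈ A, (S'.elapsed k t - S'.elapsed k τ) :=
    Finset.sum_congr rfl fun k hk => by rw [S'.elapsed_eq_zero (hA k hk), sub_zero]
  have h2 : ∑ k ∈ A, (S'.elapsed k t - S'.elapsed k τ) ≤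
      ∑ k, (S'.elapsed k t - S'.elapsed k τ) :=
    Finset.sum_le_sum_of_subset_of_nonneg (Finset.subset_univ _) fun k _ _ =>
      sub_nonneg.2 (S'.monotone_elapsed k hτ)
  rw [h1]
  refine h2.trans ?_
  rw [S'.sum_elapsed_sub]
  calc ∫ s in τ..t, ∑ k, S'.rate k s ≤ ∫ _ in τ..t, speed :=
        intervalIntegral.integral_mono_on hτ
          (by simpa only [Finset.sum_fn] using
            IntervalIntegrable.sum Finset.univ fun k _ => S'.intervalIntegrable_rate k τ t)
          intervalIntegrable_const fun s _ => S'.sum_rate_le s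
    _ = speed * (t - τ) := by simp [mul_comm]

/-- Released but inactive means finished, so under `S'` the job has received all of its processing
time. -/
theorem elapsed_le_elapsed_of_notMem_active {s s' : ℝ} (S : Schedule J s) (S' : Schedule J s')
    {k : Fin m} {t : ℝ} (hk : J.release k ≤ t) (hk' : k ∉ S'.active t) :
    S.elapsed k t ≤ S'.elapsed k t :=
  (S.elapsed_le_proc k t).trans (not_lt.1 fun hlt => hk' (S'.mem_active.2 ⟨hk, hlt⟩))

/-- Among the jobs of SETF-elapsed time at most `l`, those which only SETF has not finished carry
at most `1 / ε` times the elapsed time of those which the unit-speed schedule has not finished. -/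
theorem IsSETF.mul_sum_elapsed_le (h : S.IsSETF) (hε : 0 < ε) (S' : Schedule J 1) (t l : ℝ) :
    ε * ∑ k ∈ S.active t \ S'.active t with S.elapsed k t ≤ l, S.elapsed k t ≤
      ∑ k ∈ S'.active t with S.elapsed k t ≤ l, S.elapsed k t := by
  rcases ((S.active t \ S'.active t).filter fun k => S.elapsed k t ≤ l).eq_empty_or_nonempty
    with he | ⟨i, hi⟩
  · rw [he]
    simpa using Finset.sum_nonneg fun k _ => S.elapsed_nonneg k t
  obtain ⟨hi, hil⟩ := Finset.mem_filter.1 hi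
  obtain ⟨τ, hτ, hlow, hle, hsum⟩ := h.exists_busy_period (Finset.mem_sdiff.1 hi).1 hil
  set R : Finset (Fin m) := Finset.univ.filter fun k => τ ≤ J.release k ∧ J.release k ≤ t with hR
  have hRmem : ∀ k, k ∈ R ↔ τ ≤ J.release k ∧ J.release k ≤ t := fun k => by simp [hR]
  have hadv : ∑ k ∈ R with k ∉ S'.active t, S.elapsed k t ≤ 1 * (t - τ) :=
    (Finset.sum_le_sum fun k hk => elapsed_le_elapsed_of_notMem_active S S'
      ((hRmem k).1 (Finset.mem_filter.1 hk).1).2 (Finset.mem_filter.1 hk).2).trans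
    (S'.sum_elapsed_le_of_release hτ _ fun k hk => ((hRmem k).1 (Finset.mem_filter.1 hk).1).1)
  have hsplit := Finset.sum_filter_add_sum_filter_not R (· ∈ S'.active t) (S.elapsed · t)
  rw [hsum] at hsplit
  have hD : ∑ k ∈ S.active t \ S'.active t with S.elapsed k t ≤ l, S.elapsed k t ≤
      ∑ k ∈ R with k ∉ S'.active t, S.elapsed k t := by
    refine Finset.sum_le_sum_of_subset_of_nonneg (fun k hk => ?_) fun k _ _ => S.elapsed_nonneg k t
    obtain ⟨hk, hkl⟩ := Finset.mem_filter.1 hk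
    obtain ⟨hk, hk'⟩ := Finset.mem_sdiff.1 hk
    exact Finset.mem_filter.2 ⟨(hRmem k).2 ⟨hlow k hk hkl, (S.mem_active.1 hk).1⟩, hk'⟩
  have hX : ∑ k ∈ R with k ∈ S'.active t, S.elapsed k t ≤
      ∑ k ∈ S'.active t with S.elapsed k t ≤ l, S.elapsed k t := by
    refine Finset.sum_le_sum_of_subset_of_nonneg (fun k hk => ?_) fun k _ _ => S.elapsed_nonneg k t
    obtain ⟨hk, hk'⟩ := Finset.mem_filter.1 hk
    exact Finset.mem_filter.2 ⟨hk', hle k ((hRmem k).1 hk).1 ((hRmem k).1 hk).2⟩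
  -- Of the total `(1 + ε) * (t - τ)`, jobs finished by `S'` take at most `t - τ`, leaving `ε * (t -
  -- τ)` for those in `S'.active t`; and `D` carries at most `t - τ`.
  have hmul := mul_le_mul_of_nonneg_left hD hε.le
  have hmul' := mul_le_mul_of_nonneg_left hadv hε.le
  linarith

/-- Needed to divide by elapsed times. At level `0` the busy period has total work zero, hence
length zero, so an unprocessed active job has only just been released and is active under `S'` too.
-/
theorem IsSETF.elapsed_pos_of_mem_sdiff (h : S.IsSETF) (hε : 0 < ε) (S' : Schedule J 1) {t : ℝ}
    {i : Fin m} (hi : i ∈ S.active t \ S'.active t) : 0 < S.elapsed i t := by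
  obtain ⟨hi, hi'⟩ := Finset.mem_sdiff.1 hi
  refine (S.elapsed_nonneg i t).lt_of_ne' fun h0 => hi' ?_
  obtain ⟨τ, hτ, hlow, hle, hsum⟩ := h.exists_busy_period hi h0.le
  have hzero : ∑ k with τ ≤ J.release k ∧ J.release k ≤ t, S.elapsed k t ≤ 0 :=
    Finset.sum_nonpos fun k hk => hle k (Finset.mem_filter.1 hk).2.1 (Finset.mem_filter.1 hk).2.2
  have htτ : t ≤ τ := by
    rw [hsum] at hzero
    exact sub_nonpos.1 (nonpos_of_mul_nonpos_right hzero (by linarith))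
  obtain ⟨hrel, hlt⟩ := S.mem_active.1 hi
  refine S'.mem_active.2 ⟨hrel, ?_⟩
  rw [S'.elapsed_eq_zero (htτ.trans (hlow i hi h0.le)), ← h0]
  exact hlt

theorem IsSETF.mul_card_sdiff_le (h : S.IsSETF) (hε : 0 < ε) (S' : Schedule J 1) (t : ℝ) :
    ε * ((S.active t \ S'.active t).card : ℝ) ≤ ((S'.active t).card : ℝ) := by
  set X := S'.active t with hX
  set D := S.active t \ X with hD
  -- The sum of `a` compares the cardinalities, the sum of `a * w` the elapsed times. Restricting to
  -- `s` leaves weighted sums unchanged, loses no job of `D`, and can only lower the count of `X`.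
  let a : Fin m → ℝ := fun k => (if k ∈ X then 1 else 0) - ε * (if k ∈ D then 1 else 0)
  let s : Finset (Fin m) := Finset.univ.filter fun k => 0 < S.elapsed k t
  have key : 0 ≤ ∑ k ∈ s, a k := by
    refine sum_nonneg_of_forall_sum_filter_mul_nonneg a (S.elapsed · t) s
      (fun k hk => (Finset.mem_filter.1 hk).2) fun l => ?_
    have h1 := h.mul_sum_elapsed_le hε S' t l
    have h2 : ∑ k ∈ s with S.elapsed k t ≤ l, a k * S.elapsed k t =
        ∑ k with S.elapsed k t ≤ l, a k * S.elapsed k t := by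
      refine Finset.sum_subset (Finset.filter_subset_filter _ (Finset.subset_univ _))
        fun k hk hk' => ?_
      have h0 : S.elapsed k t = 0 := by
        refine ((S.elapsed_nonneg k t).eq_of_not_lt fun hlt => hk' ?_).symm
        exact Finset.mem_filter.2 ⟨Finset.mem_filter.2 ⟨Finset.mem_univ _, hlt⟩,
          (Finset.mem_filter.1 hk).2⟩
      rw [h0, mul_zero]
    have h3 : ∀ A : Finset (Fin m), ∑ k ∈ A with S.elapsed k t ≤ l, S.elapsed k t =
        ∑ k with S.elapsed k t ≤ l, (if k ∈ A then 1 else 0) * S.elapsed k t := fun A => by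
      simp only [ite_mul, one_mul, zero_mul, Finset.sum_ite_mem, Finset.filter_inter,
        Finset.univ_inter]
    rw [h3, h3, Finset.mul_sum, ← sub_nonneg, ← Finset.sum_sub_distrib] at h1
    rw [h2]
    refine h1.trans_eq (Finset.sum_congr rfl fun k _ => ?_)
    simp only [a, ← hX, ← hD]
    ring
  have hDs : D ⊆ s := fun k hk =>
    Finset.mem_filter.2 ⟨Finset.mem_univ _, h.elapsed_pos_of_mem_sdiff hε S' hk⟩
  have hsum : ∑ k ∈ s, a k = ((s ∩ X).card : ℝ) - ε * (D.card : ℝ) := by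
    simp only [a, Finset.sum_sub_distrib, ← Finset.mul_sum, Finset.sum_ite_mem,
      Finset.sum_const, nsmul_eq_mul, mul_one, Finset.inter_eq_right.2 hDs]
  have hcard : ((s ∩ X).card : ℝ) ≤ (X.card : ℝ) :=
    Nat.cast_le.2 (Finset.card_le_card Finset.inter_subset_right)
  linarith

theorem IsSETF.card_active_le (h : S.IsSETF) (hε : 0 < ε) (S' : Schedule J 1) (t : ℝ) :
    ((S.active t).card : ℝ) ≤ (1 + 1 / ε) * ((S'.active t).card : ℝ) := by
  have h1 := h.mul_card_sdiff_le hε S' t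
  have h2 : ((S.active t).card : ℝ) ≤
      ((S.active t \ S'.active t).card : ℝ) + ((S'.active t).card : ℝ) := by
    exact_mod_cast Finset.card_le_card_sdiff_add_card
  have h3 : ((S.active t \ S'.active t).card : ℝ) ≤ 1 / ε * ((S'.active t).card : ℝ) := by
    rw [one_div, ← div_eq_inv_mul, le_div_iff₀ hε]
    linarith
  linarith

theorem IsSETF.totalFlowTime_le (h : S.IsSETF) (hε : 0 < ε) {S' : Schedule J 1}
    (h' : S'.CompletesAll) : S.totalFlowTime ≤ (1 + 1 / ε) * S'.totalFlowTime := by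
  have hS := h.workConserving.completesAll (by linarith)
  rw [hS.totalFlowTime_eq, h'.totalFlowTime_eq, ← integral_const_mul]
  exact integral_mono hS.integrable_card_active (h'.integrable_card_active.const_mul _)
    fun t => h.card_active_le hε S' t

end Schedule

/-! ### Motions along a right-constant velocity field -/

section Path

variable {ι : Type*}

/-- A motion on `[0, T]` that starts at `0` and, at every time `t < T`, continues for a while along
a straight line with velocity `f t (w t)`. -/
structure IsPath (f : ℝ → (ι → ℝ) → ι → ℝ) (T : ℝ) (w : ℝ → ι → ℝ) : Prop where
  zero : w 0 = 0
  continuousOn : ContinuousOn w (Icc 0 T)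
  eventually_eq : ∀ t ∈ Ico 0 T, ∀ᶠ s in 𝓝[≥] t, w s = w t + (s - t) • f t (w t)

variable {f : ℝ → (ι → ℝ) → ι → ℝ} {T : ℝ} {w w' : ℝ → ι → ℝ}

theorem hasDerivWithinAt_of_eventually_eq {E : Type*} [NormedAddCommGroup E] [NormedSpace ℝ E]
    {w : ℝ → E} {v : E} {t : ℝ} (h : ∀ᶠ s in 𝓝[≥] t, w s = w t + (s - t) • v) :
    HasDerivWithinAt w v (Ici t) t := by
  have hlin : HasDerivWithinAt (fun s => w t + (s - t) • v) v (Ici t) t := by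
    simpa using ((((hasDerivAt_id t).sub_const t).smul_const v).const_add (w t)).hasDerivWithinAt
  exact hlin.congr_of_eventuallyEq h (by simp)

theorem IsPath.mono (h : IsPath f T w) {T' : ℝ} (hT : T' ≤ T) : IsPath f T' w where
  zero := h.zero
  continuousOn := h.continuousOn.mono (Icc_subset_Icc_right hT)
  eventually_eq t ht := h.eventually_eq t ⟨ht.1, ht.2.trans_le hT⟩

/-- The agreement set is closed, and from a common position both paths leave along the same line. -/
theorem IsPath.eqOn (h : IsPath f T w) (h' : IsPath f T w') : EqOn w w' (Icc 0 T) := by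
  have hclosed : IsClosed ({t | w t = w' t} ∩ Icc 0 T) := by
    have := (h.continuousOn.sub h'.continuousOn).preimage_isClosed_of_isClosed isClosed_Icc
      (isClosed_singleton (x := (0 : ι → ℝ)))
    convert this using 1
    ext t
    simp [sub_eq_zero, and_comm]
  refine hclosed.Icc_subset_of_forall_exists_gt (h.zero.trans h'.zero.symm) ?_
  rintro x ⟨hx, hxT⟩ y hy
  have h1 := (h.eventually_eq x hxT).filter_mono (nhdsWithin_mono x Ioi_subset_Ici_self)
  have h2 := (h'.eventually_eq x hxT).filter_mono (nhdsWithin_mono x Ioi_subset_Ici_self)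
  obtain ⟨s, h1, h2, h3⟩ := (h1.and (h2.and (Ioc_mem_nhdsGT hy))).exists
  refine ⟨s, ?_, h3⟩
  have hx : w x = w' x := hx
  rw [mem_ofPred_eq, h1, h2, hx]

theorem IsPath.lipschitzOnWith [Fintype ι] (h : IsPath f T w) {C : ℝ≥0} (hC : ∀ t v, ‖f t v‖ ≤ C) :
    LipschitzOnWith C w (Icc 0 T) := by
  refine LipschitzOnWith.of_dist_le_mul fun x hx y hy => ?_
  wlog hxy : x ≤ y generalizing x y
  · rw [dist_comm, dist_comm x]
    exact this y hy x hx (le_of_not_ge hxy)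
  rw [dist_comm, dist_comm x, dist_eq_norm, Real.dist_eq, abs_of_nonneg (sub_nonneg.2 hxy)]
  exact norm_image_sub_le_of_norm_deriv_right_le_segment
    (h.continuousOn.mono (Icc_subset_Icc hx.1 hy.2))
    (fun z hz => hasDerivWithinAt_of_eventually_eq
      (h.eventually_eq z ⟨hx.1.trans hz.1, hz.2.trans_le hy.2⟩))
    (fun z _ => hC z _) y ⟨hxy, le_rfl⟩

/-- A velocity field is right-locally constant along its own motion. -/
def IsRightConstant (f : ℝ → (ι → ℝ) → ι → ℝ) : Prop :=
  ∀ t w, ∀ᶠ s in 𝓝[≥] t, f s (w + (s - t) • f t w) = f t w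

/-- Right-constancy says that the velocity stays the same for a while along the line leaving `w T`,
so appending a piece of that line gives a path. -/
theorem IsPath.exists_extend (hf : IsRightConstant f) (hT : 0 ≤ T) (h : IsPath f T w) :
    ∃ T' > T, ∃ w', IsPath f T' w' := by
  obtain ⟨T', hT', hsub⟩ := mem_nhdsGE_iff_exists_Icc_subset.1 (hf T (w T))
  set v := f T (w T) with hv
  have hT' : T < T' := hT'
  let w' : ℝ → ι → ℝ := fun s => w (min s T) + (max s T - T) • v
  have hle : ∀ s ≤ T, w' s = w s := fun s hs => by simp [w', hs]
  have hge : ∀ s, T ≤ s → w' s = w T + (s - T) • v := fun s hs => by simp [w', hs]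
  refine ⟨T', hT', w', ?_, ?_, fun t ht => ?_⟩
  · rw [hle 0 hT, h.zero]
  · refine ContinuousOn.add (h.continuousOn.comp (by fun_prop) fun s hs => ?_) (by fun_prop)
    exact ⟨le_min hs.1 hT, min_le_right _ _⟩
  · rcases lt_or_ge t T with htT | hTt
    · filter_upwards [h.eventually_eq t ⟨ht.1, htT⟩,
        mem_nhdsWithin_of_mem_nhds (Iio_mem_nhds htT)] with s hs hsT
      rw [hle s (le_of_lt hsT), hle t htT.le, hs]
    · have hft : f t (w' t) = v := by
        rw [hge t hTt]
        exact hsub ⟨hTt, ht.2.le⟩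
      filter_upwards [self_mem_nhdsWithin] with s hs
      rw [hft, hge t hTt, hge s (hTt.trans hs), add_assoc, ← add_smul]
      congr 2
      ring

/-- By uniqueness the shorter paths glue to one on `[0, T)`. It is Lipschitz, hence extends
continuously to `T`, where no velocity is prescribed. Velocity changes may thus accumulate at `T`.
-/
theorem exists_isPath_of_forall_lt [Fintype ι] {C : ℝ≥0} (hC : ∀ t v, ‖f t v‖ ≤ C)
    (h : ∀ t, 0 ≤ t → t < T → ∃ w, IsPath f t w) : ∃ w, IsPath f T w := by
  rcases le_or_gt T 0 with hT | hT
  · refine ⟨0, rfl, continuousOn_const, fun t ht => ?_⟩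
    exact absurd (ht.1.trans_lt ht.2) hT.not_gt
  choose! W hW using h
  have hdiag : ∀ t, 0 ≤ t → t < T → ∀ s ∈ Icc 0 t, W s s = W t s := fun t h0 ht s hs =>
    ((hW s hs.1 (hs.2.trans_lt ht)).eqOn ((hW t h0 ht).mono hs.2)) ⟨hs.1, le_rfl⟩
  have hlip : LipschitzOnWith C (fun t => W t t) (Ico 0 T) := by
    refine LipschitzOnWith.of_dist_le_mul fun x hx y hy => ?_
    have hm : max x y < T := max_lt hx.2 hy.2
    have h0 : 0 ≤ max x y := hx.1.trans (le_max_left _ _)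
    have hx' : x ∈ Icc 0 (max x y) := ⟨hx.1, le_max_left _ _⟩
    have hy' : y ∈ Icc 0 (max x y) := ⟨hy.1, le_max_right _ _⟩
    simp only [hdiag _ h0 hm x hx', hdiag _ h0 hm y hy']
    exact ((hW _ h0 hm).lipschitzOnWith hC).dist_le_mul x hx' y hy'
  obtain ⟨g, hg, heq⟩ := hlip.extend_pi
  refine ⟨g, ?_, hg.continuous.continuousOn, fun t ht => ?_⟩
  · rw [← heq ⟨le_rfl, hT⟩]
    exact (hW 0 le_rfl hT).zero
  · obtain ⟨u, htu, huT⟩ := exists_between ht.2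
    have hu0 : 0 ≤ u := ht.1.trans htu.le
    have hgu : ∀ s ∈ Icc 0 u, g s = W u s := fun s hs => by
      rw [← heq ⟨hs.1, hs.2.trans_lt huT⟩]
      exact hdiag u hu0 huT s hs
    filter_upwards [(hW u hu0 huT).eventually_eq t ⟨ht.1, htu⟩, self_mem_nhdsWithin,
      mem_nhdsWithin_of_mem_nhds (Iio_mem_nhds htu)] with s hs hts hsu
    rw [hgu s ⟨ht.1.trans hts, le_of_lt hsu⟩, hgu t ⟨ht.1, htu.le⟩, hs]

/-- Continuation: a finite supremum of existence times would be attained, and then exceeded by an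
extension. -/
theorem exists_isPath [Fintype ι] (hf : IsRightConstant f) {C : ℝ≥0}
    (hC : ∀ t v, ‖f t v‖ ≤ C) (T : ℝ) :
    ∃ w, IsPath f T w := by
  by_contra hT
  let A : Set ℝ := {t | ∃ w, IsPath f t w}
  have hlt : ∀ t ∈ A, t < T := fun t ⟨w, hw⟩ => lt_of_not_ge fun h => hT ⟨w, hw.mono h⟩
  have hbdd : BddAbove A := ⟨T, fun t ht => (hlt t ht).le⟩
  have h0 : (0 : ℝ) ∈ A :=
    exists_isPath_of_forall_lt hC fun t h1 h2 => absurd h1 h2.not_ge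
  have hsup : ∃ w, IsPath f (sSup A) w := exists_isPath_of_forall_lt hC fun t _ ht => by
    obtain ⟨u, ⟨w, hw⟩, hu⟩ := exists_lt_of_lt_csSup ⟨0, h0⟩ ht
    exact ⟨w, hw.mono hu.le⟩
  obtain ⟨w, hw⟩ := hsup
  obtain ⟨T', hT', hw'⟩ := hw.exists_extend hf (le_csSup hbdd h0)
  exact hT'.not_ge (le_csSup hbdd hw')

theorem exists_forall_isPath [Fintype ι] (hf : IsRightConstant f) {C : ℝ≥0}
    (hC : ∀ t v, ‖f t v‖ ≤ C) :
    ∃ w, ∀ T, IsPath f T w := by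
  choose W hW using exists_isPath hf hC
  have hdiag : ∀ T, EqOn (fun t => W t t) (W T) (Icc 0 T) := fun T s hs =>
    (hW s).eqOn ((hW T).mono hs.2) ⟨hs.1, le_rfl⟩
  refine ⟨fun t => W t t, fun T => ⟨(hW 0).zero, (hW T).continuousOn.congr (hdiag T),
    fun t ht => ?_⟩⟩
  filter_upwards [(hW T).eventually_eq t ht, self_mem_nhdsWithin,
    mem_nhdsWithin_of_mem_nhds (Iio_mem_nhds ht.2)] with s hs hts hsT
  have e1 : W s s = W T s := hdiag T ⟨ht.1.trans hts, le_of_lt hsT⟩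
  have e2 : W t t = W T t := hdiag T ⟨ht.1, ht.2.le⟩
  rw [e1, e2, hs]

end Path

/-! ### Existence of SETF and SRPT schedules -/

variable {m : ℕ} (J : JobInput m) (speed : ℝ)

/-- A rule that assigns rates to the time and the elapsed times of the jobs, and that never changes
its mind immediately, is followed by some schedule. -/
theorem exists_schedule_rate_eq (f : ℝ → (Fin m → ℝ) → Fin m → ℝ)
    (hf : IsRightConstant f) (hnonneg : ∀ t w j, 0 ≤ f t w j) (hsum : ∀ t w, ∑ j, f t w j ≤ speed)
    (hzero : ∀ t w j, ¬ (J.release j ≤ t ∧ w j < J.proc j) → f t w j = 0) :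
    ∃ S : Schedule J speed, ∀ j t, S.rate j t = f t (fun k => S.elapsed k t) j := by
  have hspeed : 0 ≤ speed := (Finset.sum_nonneg fun j _ => hnonneg 0 0 j).trans (hsum 0 0)
  have hle : ∀ t w j, f t w j ≤ speed := fun t w j =>
    (Finset.single_le_sum (fun i _ => hnonneg t w i) (Finset.mem_univ j)).trans (hsum t w)
  have hC : ∀ t w, ‖f t w‖ ≤ (⟨speed, hspeed⟩ : ℝ≥0) := fun t w =>
    (pi_norm_le_iff_of_nonneg hspeed).2 fun j =>
      (Real.norm_of_nonneg (hnonneg t w j)).trans_le (hle t w j)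
  obtain ⟨W, hW⟩ := exists_forall_isPath hf hC
  let w : ℝ → Fin m → ℝ := fun t => W (max t 0)
  have hneg : ∀ t < 0, ∀ v, f t v = 0 := fun t ht v => funext fun j =>
    hzero t v j fun h => (ht.trans_le (J.release_nonneg j)).not_ge h.1
  have hw0 : ∀ t ≤ 0, w t = 0 := fun t ht => by simp [w, ht, (hW 0).zero]
  have hw : ∀ t, 0 ≤ t → w t = W t := fun t ht => by simp [w, ht]
  have hderiv : ∀ t, HasDerivWithinAt w (f t (w t)) (Ici t) t := fun t => by
    apply hasDerivWithinAt_of_eventually_eq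
    rcases lt_or_ge t 0 with ht | ht
    · filter_upwards [mem_nhdsWithin_of_mem_nhds (Iio_mem_nhds ht)] with s hs
      rw [hneg t ht, hw0 t ht.le, hw0 s (le_of_lt hs)]
      simp
    · filter_upwards [(hW (t + 1)).eventually_eq t ⟨ht, by linarith⟩, self_mem_nhdsWithin]
        with s hs hts
      rw [hw t ht, hw s (ht.trans hts), hs]
  have hderivj : ∀ j t, HasDerivWithinAt (fun s => w s j) (f t (w t) j) (Ici t) t := fun j t =>
    hasDerivWithinAt_pi.1 (hderiv t) j
  -- The rule itself is not assumed measurable; the rates are, being right derivatives of the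
  -- motion.
  have hmeas : ∀ j, Measurable fun t => f t (w t) j := fun j => by
    have : (fun t => f t (w t) j) = fun t => derivWithin (fun s => w s j) (Ici t) t :=
      funext fun t => ((hderivj j t).derivWithin (uniqueDiffWithinAt_Ici t)).symm
    rw [this]
    exact measurable_derivWithin_Ici _
  -- The fundamental theorem for right derivatives identifies the motion with the elapsed times,
  -- closing the loop between rates and rule.
  have hint : ∀ j t, ∫ s in (0 : ℝ)..t, f s (w s) j = w t j := fun j t => by
    rcases lt_or_ge t 0 with ht | ht
    · rw [hw0 t ht.le, intervalIntegral.integral_symm, intervalIntegral.integral_zero_ae]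
      · simp
      · filter_upwards [compl_mem_ae_iff.2 (measure_singleton (μ := volume) (0 : ℝ))] with x hx hx'
        rw [uIoc_of_le ht.le] at hx'
        rw [hneg x (lt_of_le_of_ne hx'.2 hx)]
        rfl
    · rw [intervalIntegral.integral_eq_sub_of_hasDeriv_right_of_le (f := fun s => w s j) ht,
        hw0 0 le_rfl]
      · simp
      · refine (continuousOn_pi.1 (hW t).continuousOn j).congr fun s hs => ?_
        simp only [hw s hs.1]
      · exact fun x _ => (hderivj j x).mono Ioi_subset_Ici_self
      · refine (intervalIntegrable_const (c := speed)).mono_fun' (hmeas j).aestronglyMeasurable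
          (ae_of_all _ fun s => ?_)
        exact (Real.norm_of_nonneg (hnonneg s _ j)).trans_le (hle s _ j)
  let S : Schedule J speed :=
    { rate := fun j t => f t (w t) j
      measurable_rate := hmeas
      rate_nonneg := fun j t => hnonneg _ _ j
      sum_rate_le := fun t => hsum _ _
      rate_eq_zero := fun j t h => hzero _ _ _ (by rwa [hint] at h) }
  refine ⟨S, fun j t => ?_⟩
  have : (fun k => S.elapsed k t) = w t := funext fun k => hint k t
  rw [this]

/-- The jobs that are active at time `t` when the elapsed times are `w`. -/
noncomputable def activeJobs (t : ℝ) (w : Fin m → ℝ) : Finset (Fin m) :=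
  Finset.univ.filter fun j => J.release j ≤ t ∧ w j < J.proc j

variable {J} in
theorem mem_activeJobs {t : ℝ} {w : Fin m → ℝ} {j : Fin m} :
    j ∈ activeJobs J t w ↔ J.release j ≤ t ∧ w j < J.proc j := by
  simp [activeJobs]

theorem tendsto_add_sub_mul (t a b : ℝ) :
    Tendsto (fun s : ℝ => a + (s - t) * b) (𝓝[≥] t) (𝓝 a) := by
  have : Continuous fun s : ℝ => a + (s - t) * b := by fun_prop
  simpa using (this.tendsto t).mono_left nhdsWithin_le_nhds

/-- Just after `t` no new job is released, unfinished jobs remain unfinished by continuity, and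
finished ones stay finished since `v` is nonnegative. -/
theorem eventually_activeJobs_eq (t : ℝ) (w : Fin m → ℝ) {v : Fin m → ℝ} (hv : ∀ j, 0 ≤ v j) :
    ∀ᶠ s in 𝓝[≥] t, activeJobs J s (w + (s - t) • v) = activeJobs J t w := by
  have key : ∀ j, ∀ᶠ s in 𝓝[≥] t,
      (J.release j ≤ s ∧ w j + (s - t) * v j < J.proc j ↔ J.release j ≤ t ∧ w j < J.proc j) := by
    intro j
    rcases lt_or_ge t (J.release j) with hr | hr
    · filter_upwards [mem_nhdsWithin_of_mem_nhds (Iio_mem_nhds hr)] with s hs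
      exact iff_of_false (fun h => (mem_Iio.1 hs).not_ge h.1) fun h => hr.not_ge h.1
    rcases lt_or_ge (w j) (J.proc j) with hp | hp
    · filter_upwards [(tendsto_add_sub_mul t (w j) (v j)).eventually_lt_const hp,
        self_mem_nhdsWithin] with s hs hts
      exact iff_of_true ⟨hr.trans hts, hs⟩ ⟨hr, hp⟩
    · filter_upwards [self_mem_nhdsWithin] with s hts
      refine iff_of_false (fun h => h.2.not_ge ?_) fun h => h.2.not_ge hp
      have : 0 ≤ (s - t) * v j := mul_nonneg (sub_nonneg.2 hts) (hv j)
      linarith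
  filter_upwards [eventually_all.2 key] with s hs
  ext j
  simpa [mem_activeJobs] using hs j

/-- The active jobs of minimum elapsed time. -/
noncomputable def leastJobs (t : ℝ) (w : Fin m → ℝ) : Finset (Fin m) :=
  (activeJobs J t w).filter fun j => ∀ k ∈ activeJobs J t w, w j ≤ w k

/-- The rates of SETF at time `t` when the elapsed times are `w`. -/
noncomputable def setfRate (t : ℝ) (w : Fin m → ℝ) (j : Fin m) : ℝ :=
  if j ∈ leastJobs J t w then speed / ((leastJobs J t w).card : ℝ) else 0

variable {speed} in
theorem setfRate_nonneg (hspeed : 0 ≤ speed) (t : ℝ) (w : Fin m → ℝ) (j : Fin m) :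
    0 ≤ setfRate J speed t w j := by
  unfold setfRate
  split_ifs
  · positivity
  · exact le_rfl

variable {speed} in
theorem sum_setfRate_le (hspeed : 0 ≤ speed) (t : ℝ) (w : Fin m → ℝ) :
    ∑ j, setfRate J speed t w j ≤ speed := by
  simp only [setfRate, Finset.sum_ite_mem, Finset.univ_inter, Finset.sum_const, nsmul_eq_mul]
  rcases eq_or_ne ((leastJobs J t w).card : ℝ) 0 with h | h
  · simpa [h] using hspeed
  · rw [mul_div_cancel₀ _ h]

variable {speed} in
-- Strict inequalities between elapsed times persist for a while, and ties at the minimum persist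
-- because tied jobs run at equal rates.
theorem isRightConstant_setfRate (hspeed : 0 ≤ speed) : IsRightConstant (setfRate J speed) := by
  intro t w
  have hlt : ∀ j k, w j < w k → ∀ᶠ s in 𝓝[≥] t, w j + (s - t) * setfRate J speed t w j <
      w k + (s - t) * setfRate J speed t w k := fun j k hjk =>
    (tendsto_add_sub_mul t _ _).eventually_lt (tendsto_add_sub_mul t _ _) hjk
  have hlt' : ∀ j k, ∀ᶠ s in 𝓝[≥] t, w j < w k → w j + (s - t) * setfRate J speed t w j <
      w k + (s - t) * setfRate J speed t w k := fun j k => by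
    by_cases hjk : w j < w k
    · exact (hlt j k hjk).mono fun s hs _ => hs
    · exact Eventually.of_forall fun s h => absurd h hjk
  filter_upwards [eventually_activeJobs_eq J t w (setfRate_nonneg J hspeed t w),
    eventually_all.2 fun j => eventually_all.2 (hlt' j)] with s hact hs
  have hleast : leastJobs J s (w + (s - t) • setfRate J speed t w) = leastJobs J t w := by
    unfold leastJobs
    rw [hact]
    refine Finset.filter_congr fun j hj => ?_
    simp only [Pi.add_apply, Pi.smul_apply, smul_eq_mul]
    refine ⟨fun h k hk => not_lt.1 fun hkj => (hs k j hkj).not_ge (h k hk), fun h k hk => ?_⟩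
    rcases (h k hk).lt_or_eq with hjk | hjk
    · exact (hs j k hjk).le
    · have hjm : j ∈ leastJobs J t w := Finset.mem_filter.2 ⟨hj, h⟩
      have hkm : k ∈ leastJobs J t w := Finset.mem_filter.2 ⟨hk, hjk ▸ h⟩
      simp only [setfRate, if_pos hjm, if_pos hkm, hjk, le_refl]
  funext j
  simp only [setfRate] at hleast ⊢
  rw [hleast]

theorem exists_isSETF {speed : ℝ} (hspeed : 0 ≤ speed) : ∃ S : Schedule J speed, S.IsSETF := by
  obtain ⟨S, hS⟩ := exists_schedule_rate_eq J speed (setfRate J speed)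
    (isRightConstant_setfRate J hspeed) (setfRate_nonneg J hspeed) (sum_setfRate_le J hspeed)
    (fun t w j hj => if_neg fun h => hj (mem_activeJobs.1 (Finset.mem_filter.1 h).1))
  exact ⟨S, fun t j => hS j t⟩

/-- The active jobs of minimum remaining processing time. -/
noncomputable def shortestJobs (t : ℝ) (w : Fin m → ℝ) : Finset (Fin m) :=
  (activeJobs J t w).filter fun j => ∀ k ∈ activeJobs J t w, J.proc j - w j ≤ J.proc k - w k

/-- The rates of SRPT, with ties broken by index, at time `t` when the elapsed times are `w`. -/
noncomputable def srptRate (t : ℝ) (w : Fin m → ℝ) : Fin m → ℝ :=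
  if h : (shortestJobs J t w).Nonempty then Pi.single ((shortestJobs J t w).min' h) speed else 0

variable {speed} in
theorem srptRate_nonneg (hspeed : 0 ≤ speed) (t : ℝ) (w : Fin m → ℝ) (j : Fin m) :
    0 ≤ srptRate J speed t w j := by
  unfold srptRate
  split_ifs with h
  · by_cases hj : j = (shortestJobs J t w).min' h
    · rw [hj, Pi.single_eq_same]
      exact hspeed
    · rw [Pi.single_eq_of_ne hj]
  · exact le_rfl

theorem shortestJobs_nonempty {t : ℝ} {w : Fin m → ℝ} (h : (activeJobs J t w).Nonempty) :
    (shortestJobs J t w).Nonempty := by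
  obtain ⟨j, hj, hmin⟩ := (activeJobs J t w).exists_min_image (fun j => J.proc j - w j) h
  exact ⟨j, Finset.mem_filter.2 ⟨hj, hmin⟩⟩

variable {speed} in
-- Once the chosen job has run for any positive time it is the unique shortest one, so the
-- tie-breaking rule has no further say. Strictness needs positive speed, and `s = t` is treated
-- apart.
theorem isRightConstant_srptRate (hspeed : 0 < speed) : IsRightConstant (srptRate J speed) := by
  intro t w
  filter_upwards [eventually_activeJobs_eq J t w (srptRate_nonneg J hspeed.le t w),
    self_mem_nhdsWithin] with s hact hts
  rcases eq_or_lt_of_le (mem_Ici.1 hts) with rfl | hts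
  · simp
  by_cases h : (shortestJobs J t w).Nonempty
  · set i := (shortestJobs J t w).min' h with hi
    obtain ⟨hia, himin⟩ := Finset.mem_filter.1 ((shortestJobs J t w).min'_mem h)
    rw [← hi] at hia himin
    have hrate : srptRate J speed t w = Pi.single i speed := by rw [srptRate, dif_pos h]
    rw [hrate] at hact ⊢
    have hpos : 0 < (s - t) * speed := mul_pos (sub_pos.2 hts) hspeed
    have hsing : shortestJobs J s (w + (s - t) • Pi.single i speed) = {i} := by
      unfold shortestJobs
      rw [hact]
      ext j
      simp only [Finset.mem_filter, Finset.mem_singleton, Pi.add_apply, Pi.smul_apply, smul_eq_mul]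
      constructor
      · rintro ⟨hj, hjmin⟩
        by_contra hji
        have := hjmin i hia
        have := himin j hj
        simp only [Pi.single_eq_same, Pi.single_eq_of_ne hji] at *
        linarith
      · intro hji
        rw [hji]
        refine ⟨hia, fun k hk => ?_⟩
        by_cases hkj : k = i
        · rw [hkj]
        · have := himin k hk
          simp only [Pi.single_eq_same, Pi.single_eq_of_ne hkj]
          linarith
    simp [srptRate, hsing]
  · have hempty : activeJobs J t w = ∅ :=
      Finset.not_nonempty_iff_eq_empty.1 fun h' => h (shortestJobs_nonempty J h')
    have h' : ¬ (shortestJobs J s (w + (s - t) • srptRate J speed t w)).Nonempty := by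
      rw [shortestJobs, hact, hempty]
      simp
    rw [srptRate, dif_neg h', srptRate, dif_neg h]

variable {speed} in
theorem sum_srptRate_le (hspeed : 0 ≤ speed) (t : ℝ) (w : Fin m → ℝ) :
    ∑ j, srptRate J speed t w j ≤ speed := by
  unfold srptRate
  split_ifs
  · simp
  · simpa using hspeed

theorem srptRate_eq_zero {t : ℝ} {w : Fin m → ℝ} {j : Fin m}
    (hj : ¬ (J.release j ≤ t ∧ w j < J.proc j)) : srptRate J speed t w j = 0 := by
  unfold srptRate
  split_ifs with h
  · refine Pi.single_eq_of_ne (fun hji => hj ?_) _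
    rw [hji]
    exact mem_activeJobs.1 (Finset.mem_filter.1 (Finset.min'_mem _ h)).1
  · rfl

theorem exists_isSRPT {speed : ℝ} (hspeed : 0 < speed) : ∃ S : Schedule J speed, S.IsSRPT := by
  obtain ⟨S, hS⟩ := exists_schedule_rate_eq J speed (srptRate J speed)
    (isRightConstant_srptRate J hspeed) (srptRate_nonneg J hspeed.le)
    (sum_srptRate_le J hspeed.le) (fun t w j => srptRate_eq_zero J speed)
  refine ⟨S, fun t ht => ?_⟩
  have hne := shortestJobs_nonempty J (t := t) (w := fun k => S.elapsed k t) ht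
  obtain ⟨hi, hmin⟩ := Finset.mem_filter.1 (Finset.min'_mem _ hne)
  refine ⟨_, hi, hmin, ?_, fun k hk => ?_⟩
  · rw [hS, srptRate, dif_pos hne, Pi.single_eq_same]
  · rw [hS, srptRate, dif_pos hne, Pi.single_eq_of_ne hk]

end FlowScheduling

theorem theorem4p2 {m : ℕ} (J : FlowScheduling.JobInput m) (ε : ℝ) (hε : 0 < ε) :
    (∃ S : FlowScheduling.Schedule J (1 + ε), S.IsSETF) ∧
    (∃ S' : FlowScheduling.Schedule J 1, S'.IsSRPT) ∧
    ∀ (S : FlowScheduling.Schedule J (1 + ε)) (S' : FlowScheduling.Schedule J 1),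
      S.IsSETF → S'.IsSRPT →
        S.CompletesAll ∧ S'.CompletesAll ∧
        (∀ t : ℝ, ((S.active t).card : ℝ) ≤ (1 + 1 / ε) * ((S'.active t).card : ℝ)) ∧
        S.totalFlowTime ≤ (1 + 1 / ε) * S'.totalFlowTime := by
  refine ⟨FlowScheduling.exists_isSETF J (by linarith),
    FlowScheduling.exists_isSRPT J one_pos, fun S S' hS hS' => ?_⟩
  have hC' := hS'.workConserving.completesAll one_pos
  exact ⟨hS.workConserving.completesAll (by linarith), hC', hS.card_active_le hε S',
    hS.totalFlowTime_le hε hC'⟩
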